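/- Let $k\ge 1$ and let $t^{1/2},t_0^{1/2},t_k^{1/2}\in\mathbb C^\times$. Fix a logarithm of $t$ whose half exponentiates to $t^{1/2}$, put $t^s=\exp(s\log t)$, and let $r_1,r_2\in\mathbb C$ satisfy $-t^{r_1}=-t_k^{1/2}t_0^{-1/2}$ and $-t^{r_2}=t_k^{1/2}t_0^{1/2}$. Assume that $t^{1/2}$ is not a root of unity, that $t_0^{1/2}t_k^{1/2}$ and $-t_0^{-1/2}t_k^{1/2}$ do not lie in $\{\pm1,\pm t^{\pm1/2},\pm t^{\pm1}\}$, and that $t_0^{1/2}t_k^{1/2}\ne(-t_0^{-1/2}t_k^{1/2})^{\pm1}$. **Algebras.** The extended two boundary Hecke algebra $H_k^{\mathrm{ext}}$ is generated by invertible elements $T_0,\dots,T_k,P$. Put $X_1=T_1^{-1}\cdots T_{k-1}^{-1}T_kT_{k-1}\cdots T_1$, $W_1=X_1T_0$, and $W_j=T_{j-1}W_{j-1}T_{j-1}$ for $2\le j\le k$. The relations are: the braid relations of affine type $C_k$ for $T_0,\dots,T_k$ (none if $k=1$); $PX_1P^{-1}=W_1^{-1}X_1W_1$, $PT_0P^{-1}=W_1^{-1}T_0W_1$,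 $PW_1P^{-1}=W_1$, and $PT_iP^{-1}=T_i$ for $1\le i\le k-1$; and $(T_i-t_i^{1/2})(T_i+t_i^{-1/2})=0$ for $0\le i\le k$, where $t_i=t$ for $0<i<k$. The algebra $TL_k^{\mathrm{ext}}$ is the quotient of $H_k^{\mathrm{ext}}$ by $p_i^{(1^3)}=0$ for $1\le i\le k-2$ and, if $k\ge2$, by $p_0^{(\emptyset,1^2)}=p_0^{(1^2,\emptyset)}$ and $p_{0^\vee}^{(\emptyset,1^2)}=p_{0^\vee}^{(1^2,\emptyset)}$. Here $p_i^{(1^3)}$ is the nonzero idempotent in the subalgebra generated by $T_i,T_{i+1}$ on which both act from the left by $-t^{-1/2}$. The elements $p_0^{(\emptyset,1^2)}$ and $p_0^{(1^2,\emptyset)}$ are the nonzero idempotents in the subalgebra generated by $T_0,T_1$ on which $T_1$ acts from the left by $-t^{-1/2}$ and $T_0$ acts by $-t_0^{-1/2}$, respectively by $t_0^{1/2}$. The elements $p_{0^\vee}^{(\emptyset,1^2)}$ and $p_{0^\vee}^{(1^2,\emptyset)}$ are defined in the same way with $T_0,t_0$ replaced by $T_{0^\vee}=W_1T_0^{-1}$,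 $t_k$. **Modules.** Let $\mathcal W_0$ be the group of signed permutations of $\{\pm1,\dots,\pm k\}$, with simple reflections $s_0,\dots,s_{k-1}$. For $\mathbf c=(c_1,\dots,c_k)\in\mathbb C^k$ put $c_{-i}=-c_i$ and $(w\mathbf c)_i=c_{w^{-1}(i)}$. Let $Z(\mathbf c)$ be the set of those positive roots $\varepsilon_i$, $\varepsilon_j\pm\varepsilon_i$ $(i<j)$ whose value on $\mathbf c$ (that is, $c_i$, respectively $c_j\pm c_i$) is $0$. Let $P(\mathbf c)$ be the set of the $\varepsilon_i$ with $c_i\in\{\pm r_1,\pm r_2\}$ and of the $\varepsilon_j\pm\varepsilon_i$ with $c_j\pm c_i\in\{1,-1\}$. For $J\subseteq P(\mathbf c)$ let $\mathcal F^{(\mathbf c,J)}$ be the set of $w\in\mathcal W_0$ whose inversion set $R(w)$ satisfies $R(w)\cap Z(\mathbf c)=\emptyset$ and $R(w)\cap P(\mathbf c)=J$. The pair $(\mathbf c,J)$ is a skew local region if for all $w\in\mathcal F^{(\mathbf c,J)}$ one has $(w\mathbf c)_1\neq0$, $(w\mathbf c)_2\ne0$, $(w\mathbf c)_1\neq-(w\mathbf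 c)_2$, $(w\mathbf c)_i\ne(w\mathbf c)_{i+1}$ and $(w\mathbf c)_i\neq(w\mathbf c)_{i+2}$ (whenever these indices are at most $k$). For $z\in\mathbb C^\times$, the calibrated module $H_k^{(z,\mathbf c,J)}$ has basis $\{v_w\mid w\in\mathcal F^{(\mathbf c,J)}\}$ and, with $\gamma_i=-t^{c_i}$ for $i\in\{\pm1,\dots,\pm k\}$, the action $$W_iv_w=\gamma_{w^{-1}(i)}v_w,\qquad Pv_w=z\,\gamma_{w^{-1}(1)}^{-1}\cdots\gamma_{w^{-1}(k)}^{-1}v_w,$$ $$T_iv_w=d_i\,v_w+\sqrt{-(d_i-t_i^{1/2})(d_i+t_i^{-1/2})}\;v_{s_iw}\qquad(0\le i\le k-1),$$ where the square root is the principal one, $v_{s_iw}=0$ if $s_iw\notin\mathcal F^{(\mathbf c,J)}$, and $$d_i=\frac{t^{1/2}-t^{-1/2}}{1-\gamma_{w^{-1}(i)}\gamma_{w^{-1}(i+1)}^{-1}}\ (i\ge1),\qquad d_0=\frac{(t_0^{1/2}-t_0^{-1/2})+(t_k^{1/2}-t_k^{-1/2})\gamma_{w^{-1}(1)}^{-1}}{1-\gamma_{w^{-1}(1)}^{-2}}.$$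 **Proposition.** Let $c\in\mathbb C$, let $\mathbf c=(c,c+1,\dots,c+k-1)$, let $(\mathbf c,J)$ be a skew local region and let $z\in\mathbb C^\times$. Suppose that $H_k^{(z,\mathbf c,J)}$ is a $TL_k^{\mathrm{ext}}$-module, i.e. that the formulas above define an action of $TL_k^{\mathrm{ext}}$. Then $Z=\sum_{i=1}^k(W_i+W_i^{-1})\in TL_k^{\mathrm{ext}}$ acts on it by a scalar: for all $v\in H_k^{(z,\mathbf c,J)}$, $$Zv=-[\![t^{2\theta}]\!]\,[k]\,v,\qquad \theta=c+\tfrac{k-1}2,\quad [\![t^{s}]\!]=t^{s/2}+t^{-s/2},\quad [k]=\frac{t^{k/2}-t^{-k/2}}{t^{1/2}-t^{-1/2}},$$ so that $-[\![t^{2\theta}]\!]\,[k]=-(t^{\theta}+t^{-\theta})\,[k]$. -/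

import Mathlib

namespace TwoBoundary

open scoped Classical

/-! ### The extended two boundary (affine type `C`) braid group -/

/-- Generators: `T 0, …, T k` and `P`. -/
inductive Gen (k : ℕ) : Type
  | T (i : Fin (k + 1))
  | P

/-- The letter `T_i`, used only for `0 ≤ i ≤ k`. -/
def wT (k i : ℕ) : FreeGroup (Gen k) := FreeGroup.of (Gen.T (Fin.ofNat (k + 1) i))

/-- The letter `P`. -/
def wP (k : ℕ) : FreeGroup (Gen k) := FreeGroup.of Gen.P

/-- The word `T_{k-1} ⋯ T_2 T_1`. -/
def wDesc (k : ℕ) : FreeGroup (Gen k) :=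
  (((List.range' 1 (k - 1)).reverse).map (wT k)).prod

/-- `X_1 = T_1⁻¹ ⋯ T_{k-1}⁻¹ T_k T_{k-1} ⋯ T_1`. -/
def wX (k : ℕ) : FreeGroup (Gen k) := (wDesc k)⁻¹ * wT k k * wDesc k

/-- The Murphy words, with indices shifted by one: `wMurphy k i` is the `(i+1)`-st one. So
`wMurphy k 0 = X_1 T_0 = T_1⁻¹ ⋯ T_{k-1}⁻¹ T_k T_{k-1} ⋯ T_1 T_0` and the `(j+1)`-st word is
`T_j` times the `j`-th one times `T_j`. -/
def wMurphy (k : ℕ) : ℕ → FreeGroup (Gen k)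
  | 0 => wX k * wT k 0
  | i + 1 => wT k (i + 1) * wMurphy k i * wT k (i + 1)

/-- The defining relations of the extended braid group: the braid relations of the diagram
`T_0 = T_1 - T_2 - ⋯ - T_{k-1} = T_k` (double edges at both ends), and the relations that
describe conjugation by `P`. -/
inductive BraidRel (k : ℕ) : FreeGroup (Gen k) → FreeGroup (Gen k) → Prop
  | comm (i j : ℕ) (hij : i + 2 ≤ j) (hj : j ≤ k) :
      BraidRel k (wT k i * wT k j) (wT k j * wT k i)
  | braid (i : ℕ) (hi : 1 ≤ i) (hik : i + 2 ≤ k) :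
      BraidRel k (wT k i * wT k (i + 1) * wT k i) (wT k (i + 1) * wT k i * wT k (i + 1))
  | left (hk : 2 ≤ k) :
      BraidRel k (wT k 0 * wT k 1 * wT k 0 * wT k 1) (wT k 1 * wT k 0 * wT k 1 * wT k 0)
  | right (hk : 2 ≤ k) :
      BraidRel k (wT k (k - 1) * wT k k * wT k (k - 1) * wT k k)
        (wT k k * wT k (k - 1) * wT k k * wT k (k - 1))
  | conjX : BraidRel k (wP k * wX k * (wP k)⁻¹) ((wMurphy k 0)⁻¹ * wX k * wMurphy k 0)
  | conjY : BraidRel k (wP k * wT k 0 * (wP k)⁻¹) ((wMurphy k 0)⁻¹ * wT k 0 * wMurphy k 0)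
  | conjZ : BraidRel k (wP k * wMurphy k 0 * (wP k)⁻¹) (wMurphy k 0)
  | conjT (i : ℕ) (hi : 1 ≤ i) (hik : i + 1 ≤ k) :
      BraidRel k (wP k * wT k i * (wP k)⁻¹) (wT k i)

/-- The extended two boundary braid group. -/
abbrev BraidGroup (k : ℕ) : Type :=
  PresentedGroup {g : FreeGroup (Gen k) | ∃ u v, BraidRel k u v ∧ g = u * v⁻¹}

/-- The element of the braid group given by a word. -/
def toBraid (k : ℕ) : FreeGroup (Gen k) →* BraidGroup k := PresentedGroup.mk _

/-! ### Parameters -/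

/-- The parameters `t^{1/2}, t_0^{1/2}, t_k^{1/2}` together with `r_1, r_2`. A logarithm of `t` is
fixed, so that all the powers `t^s = exp (s log t)` make sense; `t0h` and `tkh` stand for
`t_0^{1/2}` and `t_k^{1/2}`. -/
structure Params where
  logt : ℂ
  t0h : ℂ
  tkh : ℂ
  r1 : ℂ
  r2 : ℂ
  t0h_ne : t0h ≠ 0
  tkh_ne : tkh ≠ 0
  /-- `t^{1/2}` is not a root of unity. -/
  not_root : ∀ n : ℕ, 0 < n → Complex.exp ((1 / 2) * logt) ^ n ≠ 1
  generic : ∀ x ∈ ({t0h * tkh, -t0h⁻¹ * tkh} : Set ℂ),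
    x ≠ 1 ∧ x ≠ -1 ∧
    x ≠ Complex.exp ((1 / 2) * logt) ∧ x ≠ Complex.exp (-(1 / 2) * logt) ∧
    x ≠ -Complex.exp ((1 / 2) * logt) ∧ x ≠ -Complex.exp (-(1 / 2) * logt) ∧
    x ≠ Complex.exp logt ∧ x ≠ Complex.exp (-logt) ∧
    x ≠ -Complex.exp logt ∧ x ≠ -Complex.exp (-logt)
  generic' : t0h * tkh ≠ -t0h⁻¹ * tkh ∧ t0h * tkh ≠ (-t0h⁻¹ * tkh)⁻¹
  r1_spec : -Complex.exp (r1 * logt) = -(tkh * t0h⁻¹)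
  r2_spec : -Complex.exp (r2 * logt) = tkh * t0h

namespace Params

/-- `t^s`. -/
noncomputable def tpow (p : Params) (s : ℂ) : ℂ := Complex.exp (s * p.logt)

/-- `t^{1/2}`. -/
noncomputable def th (p : Params) : ℂ := p.tpow (1 / 2)

/-- `⟦t^s⟧ = t^{s/2} + t^{-s/2}`. -/
noncomputable def bracket (p : Params) (s : ℂ) : ℂ := p.tpow (s / 2) + p.tpow (-(s / 2))

/-- `[n] = (t^{n/2} - t^{-n/2}) / (t^{1/2} - t^{-1/2})`. -/
noncomputable def qint (p : Params) (n : ℕ) : ℂ :=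
  (p.tpow ((n : ℂ) / 2) - p.tpow (-((n : ℂ) / 2))) / (p.tpow (1 / 2) - p.tpow (-(1 / 2)))

/-- The parameter `t_i^{1/2}` of the quadratic relation of `T_i`, where `t_i = t` for
`0 < i < k`. -/
noncomputable def half (p : Params) (k i : ℕ) : ℂ :=
  if i = 0 then p.t0h else if i = k then p.tkh else p.th

end Params

/-! ### The extended two boundary Hecke algebra -/

/-- The element of the group algebra of the braid group given by a word. -/
noncomputable def grp (k : ℕ) (g : FreeGroup (Gen k)) : MonoidAlgebra ℂ (BraidGroup k) :=
  MonoidAlgebra.of ℂ (BraidGroup k) (toBraid k g)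

/-- The relations `(T_i - t_i^{1/2}) (T_i + t_i^{-1/2}) = 0` for `0 ≤ i ≤ k`. -/
inductive HeckeRel (p : Params) (k : ℕ) :
    MonoidAlgebra ℂ (BraidGroup k) → MonoidAlgebra ℂ (BraidGroup k) → Prop
  | quad (i : ℕ) (hi : i ≤ k) :
      HeckeRel p k
        ((grp k (wT k i) - algebraMap ℂ _ (p.half k i)) *
          (grp k (wT k i) + algebraMap ℂ _ (p.half k i)⁻¹)) 0

/-- The extended two boundary Hecke algebra `H_k^ext`. -/
abbrev Hext (p : Params) (k : ℕ) : Type := RingQuot (HeckeRel p k)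

/-- The element of `H_k^ext` given by a word. -/
noncomputable def hecke (p : Params) (k : ℕ) (g : FreeGroup (Gen k)) : Hext p k :=
  RingQuot.mkAlgHom ℂ (HeckeRel p k) (grp k g)

/-! ### The extended two boundary Temperley-Lieb algebra -/

/-- `q` is a nonzero idempotent in the subalgebra generated by `x` and `y`, on which `x` and `y`
act from the left by the scalars `a` and `b`. For the pairs `x, y` used below (generators of finite
Hecke algebras of type `A_2` or `B_2`) such an element is unique when it exists. -/
def IsCharIdempotent {A : Type*} [Ring A] [Algebra ℂ A] (x y : A) (a b : ℂ) (q : A) : Prop :=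
  q ∈ Algebra.adjoin ℂ {x, y} ∧ q ≠ 0 ∧ q * q = q ∧ x * q = a • q ∧ y * q = b • q

/-- The word `T_{0^∨} = W_1 T_0⁻¹`. -/
def wTvee (k : ℕ) : FreeGroup (Gen k) := wMurphy k 0 * (wT k 0)⁻¹

/-- The relations `p_i^{(1^3)} = 0`, `p_0^{(∅,1^2)} = p_0^{(1^2,∅)}` and
`p_{0^∨}^{(∅,1^2)} = p_{0^∨}^{(1^2,∅)}`. -/
inductive TLRel (p : Params) (k : ℕ) : Hext p k → Hext p k → Prop
  | typeA (i : ℕ) (hi : 1 ≤ i) (hik : i + 2 ≤ k) (q : Hext p k)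
      (hq : IsCharIdempotent (hecke p k (wT k i)) (hecke p k (wT k (i + 1)))
        (-p.th⁻¹) (-p.th⁻¹) q) :
      TLRel p k q 0
  | left (hk : 2 ≤ k) (q q' : Hext p k)
      (hq : IsCharIdempotent (hecke p k (wT k 0)) (hecke p k (wT k 1))
        (-p.t0h⁻¹) (-p.th⁻¹) q)
      (hq' : IsCharIdempotent (hecke p k (wT k 0)) (hecke p k (wT k 1))
        p.t0h (-p.th⁻¹) q') :
      TLRel p k q q'
  | right (hk : 2 ≤ k) (q q' : Hext p k)
      (hq : IsCharIdempotent (hecke p k (wTvee k)) (hecke p k (wT k 1))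
        (-p.tkh⁻¹) (-p.th⁻¹) q)
      (hq' : IsCharIdempotent (hecke p k (wTvee k)) (hecke p k (wT k 1))
        p.tkh (-p.th⁻¹) q') :
      TLRel p k q q'

/-- The extended two boundary Temperley-Lieb algebra `TL_k^ext`. -/
abbrev TLext (p : Params) (k : ℕ) : Type := RingQuot (TLRel p k)

/-- The element of `TL_k^ext` given by a word. -/
noncomputable def tl (p : Params) (k : ℕ) (g : FreeGroup (Gen k)) : TLext p k :=
  RingQuot.mkAlgHom ℂ (TLRel p k) (hecke p k g)

/-- `Z = W_1 + W_1⁻¹ + ⋯ + W_k + W_k⁻¹`. -/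
noncomputable def centralZ (p : Params) (k : ℕ) : TLext p k :=
  ∑ i ∈ Finset.range k, (tl p k (wMurphy k i) + tl p k (wMurphy k i)⁻¹)

/-! ### Signed permutations -/

/-- The set `{-k, …, -1, 1, …, k}`. -/
abbrev SIdx (k : ℕ) : Type := {x : ℤ // x ≠ 0 ∧ |x| ≤ (k : ℤ)}

instance (k : ℕ) : Neg (SIdx k) := ⟨fun x => ⟨-x.1, by simpa using x.2⟩⟩

/-- The positive index `i + 1` attached to `i : Fin k`. -/
def pos {k : ℕ} (i : Fin k) : SIdx k :=
  ⟨(i : ℤ) + 1, by omega, by rw [abs_le]; omega⟩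

/-- The index `|x| - 1` of a signed index `x`, so that `x = ± pos (absIdx x)`. -/
def absIdx {k : ℕ} (x : SIdx k) : Fin k :=
  ⟨x.1.natAbs - 1, by have := x.2.1; have := x.2.2; rw [abs_le] at this; omega⟩

/-- The group of signed permutations. -/
def W0 (k : ℕ) : Subgroup (Equiv.Perm (SIdx k)) where
  carrier := {w | ∀ x, w (-x) = -w x}
  one_mem' := fun _ => rfl
  mul_mem' := fun {a b} ha hb x => by simp [ha _, hb _]
  inv_mem' := fun {a} ha x => by
    apply a.injective
    rw [ha]
    simp

/-- The sign change `s_0` (of the index `pos i`, used for the first index). -/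
def signChange {k : ℕ} (i : Fin k) : W0 k :=
  ⟨Equiv.swap (pos i) (-pos i), fun x => by
    have h : ∀ y : SIdx k, (-y).1 = -y.1 := fun _ => rfl
    have hi : (pos i).1 = (i : ℤ) + 1 := rfl
    simp only [Equiv.swap_apply_def, Subtype.ext_iff]
    split_ifs <;> simp only [h, hi] at * <;> omega⟩

/-- The signed transposition that exchanges `pos i` with `pos j` and `-pos i` with `-pos j`; for
`j = i + 1` it is a simple reflection. -/
def transp {k : ℕ} (i j : Fin k) : W0 k :=
  ⟨Equiv.swap (pos i) (pos j) * Equiv.swap (-pos i) (-pos j), fun x => by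
    have h : ∀ y : SIdx k, (-y).1 = -y.1 := fun _ => rfl
    have hi : (pos i).1 = (i : ℤ) + 1 := rfl
    have hj : (pos j).1 = (j : ℤ) + 1 := rfl
    simp only [Equiv.Perm.mul_apply, Equiv.swap_apply_def, Subtype.ext_iff]
    split_ifs <;> simp only [h, hi, hj] at * <;> omega⟩

/-! ### Local regions and standard tableaux -/

/-- The positive roots `ε_i`, `ε_j - ε_i` and `ε_j + ε_i` (`i < j`). -/
inductive PosRoot (k : ℕ) : Type
  | single (i : Fin k)
  | diff (i j : Fin k) (h : i < j)
  | sum (i j : Fin k) (h : i < j)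

/-- The value of a positive root on `c`. -/
def PosRoot.eval {k : ℕ} (c : Fin k → ℂ) : PosRoot k → ℂ
  | .single i => c i
  | .diff i j _ => c j - c i
  | .sum i j _ => c j + c i

/-- `Z(c)`. -/
def zeroRoots {k : ℕ} (c : Fin k → ℂ) : Set (PosRoot k) := {α | α.eval c = 0}

/-- `P(c)`. -/
def poleRoots (p : Params) {k : ℕ} (c : Fin k → ℂ) : Set (PosRoot k) :=
  {α | match α with
    | .single i => c i = p.r1 ∨ c i = -p.r1 ∨ c i = p.r2 ∨ c i = -p.r2
    | .diff i j _ => c j - c i = 1 ∨ c j - c i = -1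
    | .sum i j _ => c j + c i = 1 ∨ c j + c i = -1}

/-- The inversion set `R(w)` of the positive roots that `w` makes negative, where
`w ε_i = ε_{w(i)}` and `ε_{-i} = -ε_i`. -/
def inversions {k : ℕ} (w : W0 k) : Set (PosRoot k) :=
  {α | match α with
    | .single i => (w.1 (pos i)).1 < 0
    | .diff i j _ => (w.1 (pos j)).1 < (w.1 (pos i)).1
    | .sum i j _ => (w.1 (pos j)).1 < (w.1 (-pos i)).1}

/-- The set of standard tableaux of shape `(c, J)`. -/
def stdTab (p : Params) {k : ℕ} (c : Fin k → ℂ) (J : Set (PosRoot k)) : Set (W0 k) :=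
  {w | inversions w ∩ zeroRoots c = ∅ ∧ inversions w ∩ poleRoots p c = J}

/-- The extension of `c` to signed indices by `c_{-i} = -c_i`. -/
noncomputable def cExt {k : ℕ} (c : Fin k → ℂ) (x : SIdx k) : ℂ :=
  if 0 < x.1 then c (absIdx x) else -c (absIdx x)

/-- `(w c)_i = c_{w⁻¹(i)}`. -/
noncomputable def wAct {k : ℕ} (w : W0 k) (c : Fin k → ℂ) (i : Fin k) : ℂ :=
  cExt c (w.1⁻¹ (pos i))

/-- `(c, J)` is a skew local region. -/
def IsSkewLocalRegion (p : Params) {k : ℕ} (c : Fin k → ℂ) (J : Set (PosRoot k)) : Prop :=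
  J ⊆ poleRoots p c ∧
  ∀ w ∈ stdTab p c J,
    (∀ i : Fin k, (i : ℕ) = 0 → wAct w c i ≠ 0) ∧
    (∀ i : Fin k, (i : ℕ) = 1 → wAct w c i ≠ 0) ∧
    (∀ i j : Fin k, (i : ℕ) = 0 → (j : ℕ) = 1 → wAct w c i ≠ -wAct w c j) ∧
    (∀ i j : Fin k, (j : ℕ) = i + 1 → wAct w c i ≠ wAct w c j) ∧
    (∀ i j : Fin k, (j : ℕ) = i + 2 → wAct w c i ≠ wAct w c j)

/-! ### The calibrated module `H_k^{(z,c,J)}` -/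

/-- The vector space with basis `v_w`, for `w` a standard tableau of shape `(c, J)`. -/
abbrev CalMod (p : Params) {k : ℕ} (c : Fin k → ℂ) (J : Set (PosRoot k)) : Type :=
  stdTab p c J →₀ ℂ

/-- `v_w`, which is `0` if `w` is not a standard tableau of shape `(c, J)`. -/
noncomputable def vec (p : Params) {k : ℕ} (c : Fin k → ℂ) (J : Set (PosRoot k)) (w : W0 k) :
    CalMod p c J :=
  if h : w ∈ stdTab p c J then Finsupp.single ⟨w, h⟩ 1 else 0

/-- `γ_{w⁻¹(i)}`, where `γ_x = -t^{c_x}`. -/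
noncomputable def gam (p : Params) {k : ℕ} (c : Fin k → ℂ) (w : W0 k) (i : Fin k) : ℂ :=
  -p.tpow (wAct w c i)

/-- The operator of `W_i`: `v_w ↦ γ_{w⁻¹(i)} v_w`. -/
noncomputable def opW (p : Params) {k : ℕ} (c : Fin k → ℂ) (J : Set (PosRoot k)) (i : Fin k) :
    Module.End ℂ (CalMod p c J) :=
  Finsupp.linearCombination ℂ fun w : stdTab p c J => gam p c w i • vec p c J w

/-- The operator of `P`: `v_w ↦ z γ_{w⁻¹(1)}⁻¹ ⋯ γ_{w⁻¹(k)}⁻¹ v_w`. -/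
noncomputable def opP (p : Params) {k : ℕ} (z : ℂ) (c : Fin k → ℂ) (J : Set (PosRoot k)) :
    Module.End ℂ (CalMod p c J) :=
  Finsupp.linearCombination ℂ fun w : stdTab p c J =>
    (z * ∏ i : Fin k, (gam p c w i)⁻¹) • vec p c J w

/-- The (principal) square root of `-(d - h) (d + h⁻¹)`. -/
noncomputable def offDiag (d h : ℂ) : ℂ := (-((d - h) * (d + h⁻¹))) ^ (1 / 2 : ℂ)

/-- `[T_j]_{ww}`, where `j = i + 1` in `Fin k`. -/
noncomputable def diagT (p : Params) {k : ℕ} (c : Fin k → ℂ) (i j : Fin k) (w : W0 k) : ℂ :=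
  (p.th - p.th⁻¹) / (1 - gam p c w i * (gam p c w j)⁻¹)

/-- The operator of the generator `T` that exchanges the adjacent positions `i` and `j = i + 1`. -/
noncomputable def opT (p : Params) {k : ℕ} (c : Fin k → ℂ) (J : Set (PosRoot k)) (i j : Fin k) :
    Module.End ℂ (CalMod p c J) :=
  Finsupp.linearCombination ℂ fun w : stdTab p c J =>
    diagT p c i j w • vec p c J w +
      offDiag (diagT p c i j w) p.th • vec p c J (transp i j * w)

/-- `[T_0]_{ww}`, where `i` is the first index. -/
noncomputable def diagT0 (p : Params) {k : ℕ} (c : Fin k → ℂ) (i : Fin k) (w : W0 k) : ℂ :=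
  ((p.t0h - p.t0h⁻¹) + (p.tkh - p.tkh⁻¹) * (gam p c w i)⁻¹) / (1 - ((gam p c w i)⁻¹) ^ 2)

/-- The operator of `T_0`, where `i` is the first index. -/
noncomputable def opT0 (p : Params) {k : ℕ} (c : Fin k → ℂ) (J : Set (PosRoot k)) (i : Fin k) :
    Module.End ℂ (CalMod p c J) :=
  Finsupp.linearCombination ℂ fun w : stdTab p c J =>
    diagT0 p c i w • vec p c J w +
      offDiag (diagT0 p c i w) p.t0h • vec p c J (signChange i * w)

/-- `ρ` makes the calibrated module `H_k^{(z,c,J)}` a `TL_k^ext`-module: the generators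
`T_0, …, T_{k-1}, W_1, …, W_k, P` act by the formulas that define this module. Indices in `Fin k`
start at `0`, so `wMurphy k i` is `W_{i+1}`, and `T_j` exchanges the positions `j - 1` and `j` of
`Fin k`. -/
structure IsCalibratedTLModule (p : Params) {k : ℕ} (z : ℂ) (c : Fin k → ℂ)
    (J : Set (PosRoot k)) (ρ : TLext p k →ₐ[ℂ] Module.End ℂ (CalMod p c J)) : Prop where
  map_P : ρ (tl p k (wP k)) = opP p z c J
  map_W : ∀ i : Fin k, ρ (tl p k (wMurphy k i)) = opW p c J i
  map_T : ∀ i j : Fin k, (j : ℕ) = i + 1 → ρ (tl p k (wT k j)) = opT p c J i j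
  map_T0 : ∀ i : Fin k, (i : ℕ) = 0 → ρ (tl p k (wT k 0)) = opT0 p c J i

end TwoBoundary

/-! Each basis vector $v_w$ is a joint eigenvector of the $W_i$ with eigenvalues $\gamma_{w^{-1}(i)}
= -t^{c_{w^{-1}(i)}}$, hence of $Z$. A signed permutation only permutes the $c_i$ and changes signs,
and $t^s + t^{-s}$ is even in $s$, so the eigenvalue of $Z$ is $-\sum_i (t^{c_i} + t^{-c_i})$ for
every $w$ (`sum_gam_add_inv`). As the $v_w$ form a basis, $Z$ is this scalar (`map_centralZ`). For
$c_i = c, c+1, \dots, c+k-1$ the sum consists of two geometric progressions, and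
`sum_tpow_add_tpow_neg` factors it as $[\![t^{2\theta}]\!]\,[k]$. -/

namespace TwoBoundary

/-! ### Powers of $t$ and geometric sums -/

namespace Params

lemma tpow_ne_zero (p : Params) (s : ℂ) : p.tpow s ≠ 0 := Complex.exp_ne_zero _

lemma tpow_add (p : Params) (s u : ℂ) : p.tpow (s + u) = p.tpow s * p.tpow u := by
  simp only [tpow, add_mul, Complex.exp_add]

lemma tpow_neg (p : Params) (s : ℂ) : p.tpow (-s) = (p.tpow s)⁻¹ := by
  simp only [tpow, neg_mul, Complex.exp_neg]

lemma tpow_half_sub_ne_zero (p : Params) : p.tpow (1 / 2) - p.tpow (-(1 / 2)) ≠ 0 := by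
  intro h
  -- If $t^{1/2} = t^{-1/2}$, then $t^{1/2}$ is a square root of unity.
  refine p.not_root 2 two_pos ?_
  change p.tpow (1 / 2) ^ 2 = 1
  rw [tpow_neg, sub_eq_zero] at h
  rw [sq]
  nth_rewrite 2 [h]
  exact mul_inv_cancel₀ (p.tpow_ne_zero _)

/-- The telescoping sum for `t^a + t^{a+1} + ⋯ + t^{a+n-1}`. -/
lemma sum_tpow_mul (p : Params) (a : ℂ) (n : ℕ) :
    (∑ i ∈ Finset.range n, p.tpow (a + i)) * (p.tpow (1 / 2) - p.tpow (-(1 / 2))) =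
      p.tpow (a + n - 1 / 2) - p.tpow (a - 1 / 2) := by
  rw [Finset.sum_mul]
  -- Each product is $f(i+1) - f(i)$ with $f(i) = t^{a+i-1/2}$.
  have h : ∀ i ∈ Finset.range n, p.tpow (a + i) * (p.tpow (1 / 2) - p.tpow (-(1 / 2))) =
      p.tpow (a + ((i + 1 : ℕ) : ℂ) - 1 / 2) - p.tpow (a + (i : ℂ) - 1 / 2) := by
    intro i _
    rw [mul_sub, ← tpow_add, ← tpow_add]
    congr 2
    push_cast
    ring
  rw [Finset.sum_congr rfl h, Finset.sum_range_sub (fun i : ℕ => p.tpow (a + (i : ℂ) - 1 / 2))]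
  simp

/-- `∑ (t^{c+i} + t^{-(c+i)}) = ⟦t^{2θ}⟧ [n]` for `θ = c + (n-1)/2`. -/
lemma sum_tpow_add_tpow_neg (p : Params) (c : ℂ) (n : ℕ) :
    ∑ i ∈ Finset.range n, (p.tpow (c + i) + p.tpow (-(c + i))) =
      p.bracket (2 * (c + ((n : ℂ) - 1) / 2)) * p.qint n := by
  have h := p.tpow_half_sub_ne_zero
  -- Read backwards, the exponents $-(c+i)$ increase by $1$ from $1-c-n$, so `sum_tpow_mul` covers
  -- this half too.
  have hneg : ∑ i ∈ Finset.range n, p.tpow (-(c + i)) =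
      ∑ i ∈ Finset.range n, p.tpow ((1 - c - n) + i) := by
    rw [← Finset.sum_range_reflect]
    refine Finset.sum_congr rfl fun i hi => ?_
    have hi' : i + 1 ≤ n := Finset.mem_range.1 hi
    rw [Nat.sub_sub, add_comm 1 i, Nat.cast_sub hi']
    congr 1
    push_cast
    ring
  -- Once the denominator is cleared, the four end terms have the exponents $\pm\theta \pm n/2$,
  -- which are those of $(t^{\theta}+t^{-\theta})(t^{n/2}-t^{-n/2})$.
  rw [qint, mul_div_assoc', eq_div_iff h, Finset.sum_add_distrib, add_mul, hneg,
    sum_tpow_mul, sum_tpow_mul, bracket, add_mul, mul_sub, mul_sub]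
  simp only [← tpow_add]
  ring_nf

end Params

/-! ### Signed permutations and the eigenvalues of $Z$ -/

lemma val_neg {k : ℕ} (x : SIdx k) : (-x).1 = -x.1 := rfl

lemma absIdx_pos {k : ℕ} (i : Fin k) : absIdx (pos i) = i := by
  ext
  simp only [absIdx, pos]
  omega

lemma absIdx_neg {k : ℕ} (x : SIdx k) : absIdx (-x) = absIdx x := by
  ext
  simp only [absIdx, val_neg, Int.natAbs_neg]

lemma eq_or_eq_neg_of_absIdx_eq {k : ℕ} {x y : SIdx k} (h : absIdx x = absIdx y) :
    x = y ∨ x = -y := by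
  have hx := x.2.1
  have hy := y.2.1
  simp only [absIdx, Fin.mk.injEq] at h
  simp only [Subtype.ext_iff, val_neg]
  omega

/-- A signed permutation induces a permutation of the absolute values. -/
lemma absIdx_perm_bijective {k : ℕ} (w : W0 k) :
    Function.Bijective fun i : Fin k => absIdx (w.1 (pos i)) := by
  refine Finite.injective_iff_bijective.1 fun i j h => ?_
  rw [← absIdx_pos i, ← absIdx_pos j]
  rcases eq_or_eq_neg_of_absIdx_eq h with h | h
  · rw [w.1.injective h]
  -- Opposite images have opposite preimages, since $w(-x) = -w(x)$, and these have the same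
  -- absolute value.
  · rw [← w.2 (pos j)] at h
    rw [w.1.injective h, absIdx_neg]

/-- The sign of $w^{-1}(i)$ only decides which of $t^{c}$ and $t^{-c}$ is $-\gamma$ and which is
$-\gamma^{-1}$; the sum forgets it. -/
lemma gam_add_inv (p : Params) {k : ℕ} (c : Fin k → ℂ) (w : W0 k) (i : Fin k) :
    gam p c w i + (gam p c w i)⁻¹ =
      -(p.tpow (c (absIdx (w.1⁻¹ (pos i)))) + p.tpow (-c (absIdx (w.1⁻¹ (pos i))))) := by
  rw [gam, inv_neg, ← Params.tpow_neg, wAct, cExt]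
  split_ifs
  · ring
  · rw [neg_neg]
    ring

/-- The eigenvalue of `Z` on `v_w` does not depend on `w`. -/
lemma sum_gam_add_inv (p : Params) {k : ℕ} (c : Fin k → ℂ) (w : W0 k) :
    ∑ i, (gam p c w i + (gam p c w i)⁻¹) = -∑ i, (p.tpow (c i) + p.tpow (-c i)) := by
  simp only [gam_add_inv, Finset.sum_neg_distrib]
  congr 1
  exact (absIdx_perm_bijective w⁻¹).sum_comp fun i => p.tpow (c i) + p.tpow (-c i)

/-! ### The action of $Z$ on the basis -/

lemma gam_ne_zero (p : Params) {k : ℕ} (c : Fin k → ℂ) (w : W0 k) (i : Fin k) :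
    gam p c w i ≠ 0 := neg_ne_zero.2 (p.tpow_ne_zero _)

lemma tl_inv_mul (p : Params) (k : ℕ) (g : FreeGroup (Gen k)) : tl p k g⁻¹ * tl p k g = 1 := by
  simp only [tl, hecke, grp, ← map_mul, inv_mul_cancel, map_one]

lemma opW_single (p : Params) {k : ℕ} (c : Fin k → ℂ) (J : Set (PosRoot k)) (i : Fin k)
    (w : stdTab p c J) :
    opW p c J i (Finsupp.single w 1) = gam p c w i • Finsupp.single w 1 := by
  rw [opW, Finsupp.linearCombination_single, one_smul, vec, dif_pos w.2]

/-- `map_W` prescribes $W_i$ alone; the action of $W_i^{-1}$ is forced by applying $W_i^{-1}W_i = 1$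
to $v_w$ and dividing by the nonzero eigenvalue. -/
lemma IsCalibratedTLModule.map_W_inv_single {p : Params} {k : ℕ} {z : ℂ} {c : Fin k → ℂ}
    {J : Set (PosRoot k)} {ρ : TLext p k →ₐ[ℂ] Module.End ℂ (CalMod p c J)}
    (hρ : IsCalibratedTLModule p z c J ρ) (i : Fin k) (w : stdTab p c J) :
    ρ (tl p k (wMurphy k i)⁻¹) (Finsupp.single w 1) =
      (gam p c w i)⁻¹ • Finsupp.single w 1 := by
  have h := congrArg (fun f => ρ f (Finsupp.single w 1)) (tl_inv_mul p k (wMurphy k i))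
  simp only [map_mul, map_one, Module.End.mul_apply, Module.End.one_apply, hρ.map_W,
    opW_single, map_smul] at h
  rw [eq_inv_smul_iff₀ (gam_ne_zero p c w i), h]

/-- `Z` acts on a calibrated module by a scalar that depends only on `c`. -/
lemma IsCalibratedTLModule.map_centralZ {p : Params} {k : ℕ} {z : ℂ} {c : Fin k → ℂ}
    {J : Set (PosRoot k)} {ρ : TLext p k →ₐ[ℂ] Module.End ℂ (CalMod p c J)}
    (hρ : IsCalibratedTLModule p z c J ρ) :
    ρ (centralZ p k) = (-∑ i, (p.tpow (c i) + p.tpow (-c i))) • 1 := by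
  -- It suffices to compare the two endomorphisms on each $v_w$.
  refine Finsupp.lhom_ext' fun w => LinearMap.ext_ring ?_
  simp only [LinearMap.comp_apply, Finsupp.lsingle_apply, LinearMap.smul_apply,
    Module.End.one_apply]
  -- The scalar is turned back into the sum of eigenvalues for this particular $w$, so that the two
  -- sides match term by term.
  rw [← sum_gam_add_inv p c w, centralZ,
    Finset.sum_range fun i => tl p k (wMurphy k i) + tl p k (wMurphy k i)⁻¹, map_sum,
    LinearMap.sum_apply, Finset.sum_smul]
  refine Finset.sum_congr rfl fun i _ => ?_
  rw [map_add, LinearMap.add_apply, hρ.map_W, opW_single, hρ.map_W_inv_single, add_smul]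

end TwoBoundary

theorem proposition4p4 (p : TwoBoundary.Params) (k : ℕ) (hk : 1 ≤ k) (c z : ℂ) (hz : z ≠ 0)
    (cs : Fin k → ℂ) (hcs : ∀ i : Fin k, cs i = c + ((i : ℕ) : ℂ))
    (J : Set (TwoBoundary.PosRoot k)) (hJ : TwoBoundary.IsSkewLocalRegion p cs J)
    (ρ : TwoBoundary.TLext p k →ₐ[ℂ] Module.End ℂ (TwoBoundary.CalMod p cs J))
    (hρ : TwoBoundary.IsCalibratedTLModule p z cs J ρ)
    (θ : ℂ) (hθ : θ = c + ((k : ℂ) - 1) / 2) (v : TwoBoundary.CalMod p cs J) :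
    ρ (TwoBoundary.centralZ p k) v = (-(p.bracket (2 * θ) * p.qint k)) • v := by
  subst hθ
  rw [hρ.map_centralZ, LinearMap.smul_apply, Module.End.one_apply,
    ← p.sum_tpow_add_tpow_neg, Finset.sum_range]
  simp only [hcs]
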